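/- Let $N\ge 1$ base stations have cells $\mathcal C_1,\dots,\mathcal C_N\subset\mathbb R^2$ (measurable, of finite area) and let there be $M$ contents, content $i$ being requested inside $\mathcal C:=\bigcup_j\mathcal C_j$ according to a homogeneous Poisson process of intensity $\lambda_i\ge 0$ per unit time and area. Every station stores exactly $K<M$ contents: let $\mathcal B$ be the set of matrices $B\in\{0,1\}^{M\times N}$ with $\sum_i B_{i,j}=K$ for every $j$. For $s\subseteq\{1,\dots,N\}$ let $\mathcal C(s)$ be the set of points of $\mathcal C$ that are covered by every station of $s$ and by no other station, let $|\mathcal C(s)|$ be its area, and let $$h(B):=\sum_{s}|\mathcal C(s)|\sum_{i=1}^M\lambda_i\,\mathbf 1\Big\{\sum_{j\in s}B_{i,j}\ge 1\Big\},\qquad \Delta:=\max_{\mathcal B}h-\min_{\mathcal B}h .$$ Let $\beta_0>0$ satisfy $\beta_0N\Delta<1$ and $\beta_0\max_{\mathcal B}h<1$, and put $\beta_t:=\beta_0\log(1+\lfloor t/N\rfloor)$. In slot $t$, station $k$ has a (random) estimate $\hat\theta(k,i,s,t)$ of $\lambda_i|\mathcal C(s)|$; let $\hat h_{k,t}(B):=\sum_s\sum_i\hat\theta(k,i,s,t)\,\mathbf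 1\{\sum_{j\in s}B_{i,j}\ge1\}$. Virtual-cache update: start from an arbitrary $V(0)\in\mathcal B$. In each slot $t\ge1$ choose a station $j_t$ uniformly at random and, given $j_t=k$ and $V(t-1)=B$, let $V(t)=A$ with probability $e^{\beta_t\hat h_{k,t}(A)}/\sum_{A'}e^{\beta_t\hat h_{k,t}(A')}$ if $A\in\mathcal B$ agrees with $B$ in all columns other than the $k$-th, and with probability $0$ otherwise; here the sum is over all $A'\in\mathcal B$ that agree with $B$ in all columns other than the $k$-th. Thus, given the estimates, $\{V(t)\}$ is an inhomogeneous Markov chain on $\mathcal B$; let $P(m;n)$ be its transition matrix between the times $m$ and $m+n$. Assume that $\lim_{t\to\infty}\hat\theta(k,i,s,t)=\lambda_i|\mathcal C(s)|$ almost surely for all $k,i,s$, and that $h$ has exactly one maximizer on $\mathcal B$. Then there is a probability distribution $\pi_{v,\infty}$ on $\mathcal B$ with $\pi_{v,\infty}(\arg\max_{B\in\mathcal B}h(B))=1$ such that, for almost every realization of the estimates, $\{V(t)\}$ is strongly ergodic with limiting distribution $\pi_{v,\infty}$: for all $m\ge0$, $$\lim_{n\to\infty}\ \sup_{\mu}\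 d_V\big(\mu P(m;n),\pi_{v,\infty}\big)=0,$$ where $\mu$ ranges over all probability distributions on $\mathcal B$ and $d_V$ is the total variation distance. In particular, $\mathbf P(V(t)=B)\to\pi_{v,\infty}(B)$ for every $B\in\mathcal B$. -/

import Mathlib

open MeasureTheory Filter Topology

noncomputable section

namespace CacheGibbs

/-- The plane in which the base stations and the users live. -/
abbrev Plane := EuclideanSpace ℝ (Fin 2)

/-- Feasible placements: `M × N` matrices with entries `0, 1` all of whose columns sum to `K`. -/
abbrev Config (M N K : ℕ) := {B : Matrix (Fin M) (Fin N) (Fin 2) // ∀ j, ∑ i, (B i j : ℕ) = K}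

/-- `𝒞(s)`: the points of the covered region `⋃ j, cell j` that are covered by all the stations of
`s` and by no other station. -/
def region {N : ℕ} (cell : Fin N → Set Plane) (s : Finset (Fin N)) : Set Plane :=
  (⋃ j, cell j) ∩ ((⋂ j ∈ s, cell j) ∩ (⋃ j ∈ sᶜ, cell j)ᶜ)

/-- `λ_i |𝒞(s)|`: the rate of the requests for content `i` that come from `𝒞(s)`. -/
def requestRate {M N : ℕ} (lam : Fin M → ℝ) (cell : Fin N → Set Plane)
    (i : Fin M) (s : Finset (Fin N)) : ℝ :=
  lam i * (volume (region cell s)).toReal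

/-- The cache hit rate of the placement `B` when requests for content `i` come from `𝒞(s)` at
rate `θ i s`. -/
def hitRate {M N K : ℕ} (θ : Fin M → Finset (Fin N) → ℝ) (B : Config M N K) : ℝ :=
  ∑ s : Finset (Fin N), ∑ i : Fin M, θ i s * (if 1 ≤ ∑ j ∈ s, (B.1 i j : ℕ) then 1 else 0)

/-- The set of maximizers of `H`. -/
def argmax {S : Type*} (H : S → ℝ) : Set S := {B | ∀ B', H B' ≤ H B}

/-- `A` and `B` agree outside column `j`. -/
def AgreeOff {M N K : ℕ} (j : Fin N) (A B : Config M N K) : Prop :=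
  ∀ k, k ≠ j → ∀ i, A.1 i k = B.1 i k

open Classical in
/-- `π_β(A | B_{·,-j})` for the Gibbs distribution `π_β ∝ exp (β H)`: the probability of moving
from `B` to `A` when station `j` resamples its virtual cache. -/
def gibbsCond {M N K : ℕ} (β : ℝ) (H : Config M N K → ℝ) (j : Fin N) (B A : Config M N K) : ℝ :=
  if AgreeOff j A B then
    Real.exp (β * H A) /
      (∑ A' : Config M N K, if AgreeOff j A' B then Real.exp (β * H A') else 0)
  else 0

/-- The inverse temperature `β_t = β₀ log (1 + l)` for `l N ≤ t ≤ l N + N - 1`. -/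
def invTemp (N : ℕ) (β₀ : ℝ) (t : ℕ) : ℝ := β₀ * Real.log (1 + ((t / N : ℕ) : ℝ))

/-- The transition matrix from `V(t)` to `V(t+1)` for given estimates `θ`: in slot `t + 1` a
uniformly chosen station `k` resamples its virtual cache at inverse temperature `β_{t+1}`, using
its own estimates `θ k i s (t + 1)` of the request rates. -/
def learningTPM {M N : ℕ} (K : ℕ) (β₀ : ℝ)
    (θ : Fin N → Fin M → Finset (Fin N) → ℕ → ℝ) (t : ℕ) :
    Matrix (Config M N K) (Config M N K) ℝ :=
  Matrix.of fun B A => ∑ k : Fin N, (1 / (N : ℝ)) *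
    gibbsCond (invTemp N β₀ (t + 1)) (hitRate fun i s => θ k i s (t + 1)) k B A

/-- `P(m; n)`: the transition matrix between the times `m` and `m + n` of the inhomogeneous chain
whose transition matrix between `t` and `t + 1` is `Q t`. -/
def transition {S : Type*} [Fintype S] [DecidableEq S] (Q : ℕ → Matrix S S ℝ) (m : ℕ) :
    ℕ → Matrix S S ℝ
  | 0 => 1
  | n + 1 => transition Q m n * Q (m + n)

/-- Total variation distance of two distributions on a finite set. -/
def tvDist {S : Type*} [Fintype S] (μ ν : S → ℝ) : ℝ := (1 / 2) * ∑ x, |μ x - ν x|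

/-- The inhomogeneous chain with transition matrices `Q t` is strongly ergodic, with limiting
distribution `π`. -/
def StronglyErgodicTo {S : Type*} [Fintype S] [DecidableEq S] (Q : ℕ → Matrix S S ℝ)
    (π : S → ℝ) : Prop :=
  π ∈ stdSimplex ℝ S ∧ ∀ m : ℕ, Tendsto
    (fun n : ℕ => ⨆ μ : stdSimplex ℝ S, tvDist (Matrix.vecMul (μ : S → ℝ) (transition Q m n)) π)
    atTop (𝓝 0)

/-- The process `V` is generated by the annealed virtual cache update with estimates `θ`: the
estimates are part of the initial information, so that, given them, `V` is an inhomogeneous Markov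
chain, started arbitrarily, that moves from `V t` according to the row `V t` of `learningTPM`. -/
structure IsLearningChain {Ω : Type*} {mΩ : MeasurableSpace Ω} (P : Measure Ω) {M N K : ℕ}
    (β₀ : ℝ) (θ : Fin N → Fin M → Finset (Fin N) → ℕ → Ω → ℝ)
    (ℱ : Filtration ℕ mΩ) (V : ℕ → Ω → Config M N K) : Prop where
  estimates : ∀ k i s t, Measurable[ℱ 0] (θ k i s t)
  adapted : ∀ t A, MeasurableSet[ℱ t] {ω | V t ω = A}
  step : ∀ t A, P[Set.indicator {ω | V (t + 1) ω = A} (fun _ => (1 : ℝ)) | ℱ t] =ᵐ[P]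
    fun ω => learningTPM K β₀ (fun k i s t => θ k i s t ω) t (V t ω) A

end CacheGibbs

end

/-! The limit is the point mass at the unique maximizer `B`, so the claim is that the mass away from
`B` vanishes. The estimates converge without a rate: nothing makes the variations of the successive
Gibbs measures summable, and the argument does not compare them. It looks back from a time `T` over
the last `T / 2` steps. There the inverse temperature varies by O(1) and the estimation error in the
exponents is o(β_T), so every kernel is entrywise within a factor κ = exp(2εβ_T), a small power of
`T`, of one reversible kernel: the Gibbs sampler for the true `h` at β_T.

Perturbations that vary in time destroy reversibility, but `exists_robust_lyapunov` supplies an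
adversarial form of Kac's formula: the worst-case cost of reaching `B` has drift at `B` at most κ^e
π(Bᶜ)/π(B). The gap γ below the maximum makes this a negative power of `T`, which beats log T. That
function comes with no size bound; `rank_lyapunov` gives an explicit one of size O(T^ρ), where ρ =
β₀N(Δ + 2ε) < 1. The minimum of the two decreases by one off `B`, has small drift at `B`, and is
o(T).

`mass_away_le` turns this into H/n + η(1 + log n). By Markov's inequality, H/n bounds the chance of
not yet having hit `B`, and an excursion begun i steps before the end is still running with chance
at most about η/i; summing over i gives the logarithm. Bounded convergence then passes from the
conditional laws given the estimates to the law of `V`. -/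

namespace CacheGibbs

/-! ### Worst-case hitting costs for perturbed reversible kernels -/

/-- Every reversible kernel `r` on `insert B s` in which `B` is reachable from everywhere has a
Lyapunov function for the hitting time of `B` that works simultaneously for all the rows that are
within a factor `κ` of those of `r`; its drift at `B` is controlled by the reversible measure. -/
theorem exists_robust_lyapunov {S : Type*} [Fintype S] [DecidableEq S] (B : S) (d : S → ℕ)
    (s : Finset S) : B ∉ s → ∃ e : ℕ, ∀ (κ : ℝ) (r : S → S → ℝ) (π c : S → ℝ), 1 ≤ κ →
      (∀ x y, 0 ≤ r x y) → (∀ x, 0 ≤ π x) → (∀ x, 0 ≤ c x) →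
      (∀ x y, π x * r x y = π y * r y x) →
      (∀ x ∈ s, ∃ y ∈ insert B s, d y < d x ∧ 0 < r x y) →
      ∃ f : S → ℝ, f B = 0 ∧ (∀ x, 0 ≤ f x) ∧
        (∀ x ∈ s, ∀ q : S → ℝ,
          (∀ y ∈ insert B s, y ≠ x → r x y / κ ≤ q y ∧ q y ≤ κ * r x y) →
          c x ≤ ∑ y ∈ insert B s, q y * (f x - f y)) ∧
        π B * ∑ y ∈ insert B s, r B y * f y ≤ κ ^ e * ∑ x ∈ s, π x * c x := by
  induction s using Finset.induction_on_max_value d with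
  | empty =>
    intro _
    refine ⟨0, fun κ r π c _ _ _ _ _ _ => ⟨0, rfl, fun _ => le_rfl, by simp, by simp⟩⟩
  | insert z s hz hmax ih =>
    intro hB
    have hBz : B ≠ z := fun h => hB (h ▸ Finset.mem_insert_self _ _)
    have hBs : B ∉ s := fun h => hB (Finset.mem_insert_of_mem h)
    obtain ⟨e, he⟩ := ih hBs
    -- Removing `z` replaces κ by κ^3, hence `3 * e`; the remaining four powers are two from the
    -- bound on `F p` and two from the enlarged cost.
    refine ⟨4 + 3 * e, fun κ r π c hκ hr hπ hc hrev hd => ?_⟩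
    have hκ0 : 0 < κ := by linarith
    set W := insert B s with hW
    have hzW : z ∉ W := by simp [hW, hBz.symm, hz]
    have hIW : insert B (insert z s) = insert z W := Finset.insert_comm _ _ _
    rw [hIW] at hd ⊢
    set R := ∑ y ∈ W, r z y with hRdef
    have hR : 0 < R := by
      obtain ⟨y, hy, hdy, hry⟩ := hd z (Finset.mem_insert_self _ _)
      have hyz : y ≠ z := by rintro rfl; exact lt_irrefl _ hdy
      have hyW : y ∈ W := Finset.mem_of_mem_insert_of_ne hy hyz
      exact Finset.sum_pos' (fun y _ => hr z y) ⟨y, hyW, hry⟩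
    -- The chain watched off `z`: a jump to `z` is followed at once by the exit from `z`, and the
    -- cost of the stay there, with slack κ^2, is charged to the state it came from. The same `π`
    -- stays reversible.
    obtain ⟨f', hf'B, hf'0, hf'c, hf'π⟩ := he (κ ^ 3) (fun x y => r x y + r x z * r z y / R) π
      (fun x => c x + κ ^ 2 * (r x z * c z / R)) (one_le_pow₀ hκ)
      (fun x y => add_nonneg (hr _ _) (div_nonneg (mul_nonneg (hr _ _) (hr _ _)) hR.le)) hπ
      (fun x => add_nonneg (hc _) (mul_nonneg (by positivity)
        (div_nonneg (mul_nonneg (hr _ _) (hc _)) hR.le)))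
      (fun x y => by
        have h1 := hrev x y
        have h2 := hrev x z
        have h3 := hrev y z
        have : π x * r x z * r z y = π y * r y z * r z x := by rw [h2, h3]; ring
        rw [mul_add, mul_add, h1, mul_div_assoc', mul_div_assoc', ← mul_assoc, ← mul_assoc, this])
      (fun x hx => by
        -- As `z` has maximal rank, the lower neighbour of `x` is not `z` and survives its removal.
        obtain ⟨y, hy, hdy, hry⟩ := hd x (Finset.mem_insert_of_mem hx)
        have hyz : y ≠ z := by rintro rfl; exact absurd hdy (not_lt.2 (hmax x hx))
        exact ⟨y, Finset.mem_of_mem_insert_of_ne hy hyz, hdy,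
          add_pos_of_pos_of_nonneg hry (div_nonneg (mul_nonneg (hr _ _) (hr _ _)) hR.le)⟩)
    -- the worst row at `z`
    set F : (S → ℝ) → ℝ := fun q => (c z + ∑ y ∈ W, q y * f' y) / ∑ y ∈ W, q y with hF
    set K : Set (S → ℝ) := Set.Icc (fun y => r z y / κ) (fun y => κ * r z y) with hK
    have hKpos : ∀ q ∈ K, R / κ ≤ ∑ y ∈ W, q y := fun q hq => by
      rw [hRdef, Finset.sum_div]
      exact Finset.sum_le_sum fun y _ => hq.1 y
    have hle : ∀ y, r z y / κ ≤ r z y ∧ r z y ≤ κ * r z y := fun y =>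
      ⟨div_le_self (hr _ _) hκ, le_mul_of_one_le_left (hr _ _) hκ⟩
    have hKne : K.Nonempty := ⟨fun y => r z y, fun y => (hle y).1, fun y => (hle y).2⟩
    have hRκ : 0 < R / κ := by positivity
    have hFc : ContinuousOn F K := by
      apply ContinuousOn.div
      · fun_prop
      · fun_prop
      · exact fun q hq => ((hRκ.trans_le (hKpos q hq)).ne')
    obtain ⟨p, hpK, hpmax⟩ := isCompact_Icc.exists_isMaxOn hKne hFc
    have hp0 : ∀ y, 0 ≤ p y := fun y => (div_nonneg (hr z y) hκ0.le).trans (hpK.1 y)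
    set A := ∑ y ∈ W, p y with hA
    have hA1 : R / κ ≤ A := hKpos p hpK
    have hA0 : 0 < A := hRκ.trans_le hA1
    have hA2 : A ≤ κ * R := by
      rw [hA, hRdef, Finset.mul_sum]; exact Finset.sum_le_sum fun y _ => hpK.2 y
    have hFp : F p = (c z + ∑ y ∈ W, p y * f' y) / A := rfl
    have hFp0 : 0 ≤ F p := div_nonneg (add_nonneg (hc _)
      (Finset.sum_nonneg fun y _ => mul_nonneg (hp0 y) (hf'0 y))) hA0.le
    have hinvA : 1 / A ≤ κ / R := by
      rw [div_le_div_iff₀ hA0 hR]; rw [div_le_iff₀ hκ0] at hA1; linarith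
    have hinvA' : 1 / (κ * R) ≤ 1 / A := one_div_le_one_div_of_le hA0 hA2
    set f := Function.update f' z (F p) with hf
    have hfz : f z = F p := by simp [hf]
    have hfne : ∀ y, y ≠ z → f y = f' y := fun y hy => by simp [hf, hy]
    have hfW : ∀ y ∈ W, f y = f' y := fun y hy => hfne y (by rintro rfl; exact hzW hy)
    refine ⟨f, by rw [hfne B hBz, hf'B], fun x => ?_, fun x hx q hq => ?_, ?_⟩
    · by_cases hxz : x = z
      · rw [hxz, hfz]; exact hFp0
      · rw [hfne x hxz]; exact hf'0 x
    · rw [Finset.sum_insert hzW]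
      rw [Finset.mem_insert] at hx
      by_cases hxz : x = z
      · subst hxz
        have hneW : ∀ y ∈ W, y ≠ x := fun y hy => by rintro rfl; exact hzW hy
        -- `F` sees only the values on `W`; filling in `r` elsewhere puts the row in the compact box
        -- `K`, where `p` is the maximizer.
        set q' : S → ℝ := fun y => if y ∈ W then q y else r x y with hq'
        have hq'K : q' ∈ K := by
          constructor <;> intro y <;> by_cases hy : y ∈ W
          · simpa [hq', hy] using (hq y (Finset.mem_insert_of_mem hy) (hneW y hy)).1
          · simpa [hq', hy] using (hle y).1
          · simpa [hq', hy] using (hq y (Finset.mem_insert_of_mem hy) (hneW y hy)).2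
          · simpa [hq', hy] using (hle y).2
        have h1 : F q' ≤ F p := hpmax hq'K
        have h2 : 0 < ∑ y ∈ W, q' y := hRκ.trans_le (hKpos q' hq'K)
        rw [hF] at h1
        simp only at h1
        rw [div_le_iff₀ h2] at h1
        have e1 : ∑ y ∈ W, q' y = ∑ y ∈ W, q y :=
          Finset.sum_congr rfl fun y hy => by simp [hq', hy]
        have e2 : ∑ y ∈ W, q' y * f' y = ∑ y ∈ W, q y * f' y :=
          Finset.sum_congr rfl fun y hy => by simp [hq', hy]
        have e3 : ∑ y ∈ W, q y * (f x - f y) = F p * ∑ y ∈ W, q y - ∑ y ∈ W, q y * f' y := by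
          rw [Finset.mul_sum, ← Finset.sum_sub_distrib]
          exact Finset.sum_congr rfl fun y hy => by rw [hfz, hfW y hy]; ring
        rw [e1, e2] at h1
        rw [e3, sub_self, mul_zero, zero_add]
        change _ ≤ F p * _ at h1
        linarith
      · have hxs : x ∈ s := hx.resolve_left hxz
        have hqz := hq z (Finset.mem_insert_self _ _) (Ne.symm hxz)
        have hqz0 : 0 ≤ q z := (div_nonneg (hr _ _) hκ0.le).trans hqz.1
        -- The row `q` with its jump to `z` continued by the worst exit `p / A`. Each of `q z`, `p
        -- y` and `1 / A` costs one factor κ, whence κ^3.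
        have key := hf'c x hxs (fun y => q y + q z * p y / A) (fun y hy hyx => by
          have hqy := hq y (Finset.mem_insert_of_mem hy) hyx
          have h1 : r x y / κ ^ 3 ≤ r x y / κ := by
            apply div_le_div_of_nonneg_left (hr _ _) hκ0
            calc κ = κ ^ 1 := (pow_one _).symm
              _ ≤ κ ^ 3 := pow_le_pow_right₀ hκ (by norm_num)
          have h2 : κ * r x y ≤ κ ^ 3 * r x y := by
            apply mul_le_mul_of_nonneg_right _ (hr _ _)
            calc κ = κ ^ 1 := (pow_one _).symm
              _ ≤ κ ^ 3 := pow_le_pow_right₀ hκ (by norm_num)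
          have h3 : r x z * r z y / R / κ ^ 3 ≤ q z * p y / A := by
            calc r x z * r z y / R / κ ^ 3 = (r x z / κ) * (r z y / κ) * (1 / (κ * R)) := by
                  field_simp
              _ ≤ q z * p y * (1 / A) := by
                  apply mul_le_mul _ hinvA' (by positivity) (mul_nonneg hqz0 (hp0 y))
                  exact mul_le_mul hqz.1 (hpK.1 y) (div_nonneg (hr _ _) hκ0.le) hqz0
              _ = q z * p y / A := by ring
          have h4 : q z * p y / A ≤ κ ^ 3 * (r x z * r z y / R) := by
            calc q z * p y / A = q z * p y * (1 / A) := by ring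
              _ ≤ (κ * r x z) * (κ * r z y) * (κ / R) := by
                  apply mul_le_mul _ hinvA (by positivity)
                    (mul_nonneg (mul_nonneg hκ0.le (hr _ _)) (mul_nonneg hκ0.le (hr _ _)))
                  exact mul_le_mul hqz.2 (hpK.2 y) (hp0 y) (mul_nonneg hκ0.le (hr _ _))
              _ = κ ^ 3 * (r x z * r z y / R) := by ring
          constructor
          · rw [add_div]; linarith [hqy.1]
          · rw [mul_add]; linarith [hqy.2])
        have h5 : q z * c z / A ≤ κ ^ 2 * (r x z * c z / R) := by
          calc q z * c z / A = q z * c z * (1 / A) := by ring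
            _ ≤ (κ * r x z) * c z * (κ / R) := by
                apply mul_le_mul _ hinvA (by positivity)
                  (mul_nonneg (mul_nonneg hκ0.le (hr _ _)) (hc _))
                exact mul_le_mul_of_nonneg_right hqz.2 (hc _)
            _ = κ ^ 2 * (r x z * c z / R) := by ring
        have e1 : ∑ y ∈ W, (q y + q z * p y / A) * (f' x - f' y)
            = ∑ y ∈ W, q y * (f x - f y) + q z * (f x - f z) + q z * c z / A := by
          have e2 : ∑ y ∈ W, (q y + q z * p y / A) * (f' x - f' y)
              = ∑ y ∈ W, q y * (f' x - f' y) + (q z / A) * (∑ y ∈ W, p y * f' x)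
                - (q z / A) * ∑ y ∈ W, p y * f' y := by
            rw [Finset.mul_sum, Finset.mul_sum, ← Finset.sum_add_distrib, ← Finset.sum_sub_distrib]
            exact Finset.sum_congr rfl fun y _ => by ring
          rw [e2, ← Finset.sum_mul, ← hA, hfz, hFp, hfne x hxz]
          have e3 : ∑ y ∈ W, q y * (f' x - f y) = ∑ y ∈ W, q y * (f' x - f' y) :=
            Finset.sum_congr rfl fun y hy => by rw [hfW y hy]
          rw [e3]
          field_simp
          ring
        rw [e1] at key
        linarith
    · have hBW : B ∈ W := Finset.mem_insert_self _ _
      rw [Finset.sum_insert hzW, Finset.sum_insert hz, hfz,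
        Finset.sum_congr rfl fun y hy => by rw [hfW y hy]]
      have hFle : F p ≤ κ * (c z / R) + κ ^ 2 * ∑ y ∈ W, r z y * f' y / R := by
        calc F p = (c z + ∑ y ∈ W, p y * f' y) * (1 / A) := by rw [hFp]; ring
          _ ≤ (c z + ∑ y ∈ W, (κ * r z y) * f' y) * (κ / R) := by
              apply mul_le_mul _ hinvA (by positivity)
                (add_nonneg (hc _) (Finset.sum_nonneg fun y _ =>
                  mul_nonneg (mul_nonneg hκ0.le (hr _ _)) (hf'0 y)))
              gcongr with y hy
              · exact hf'0 y
              · exact hpK.2 y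
          _ = κ * (c z / R) + κ ^ 2 * ∑ y ∈ W, r z y * f' y / R := by
              rw [← Finset.sum_div, add_mul]
              have : ∑ y ∈ W, (κ * r z y) * f' y = κ * ∑ y ∈ W, r z y * f' y := by
                rw [Finset.mul_sum]; exact Finset.sum_congr rfl fun y _ => by ring
              rw [this]; ring
      have hκ2 : 1 ≤ κ ^ 2 := one_le_pow₀ hκ
      have hκe : 1 ≤ (κ ^ 3) ^ e := one_le_pow₀ (one_le_pow₀ hκ)
      set X := ∑ x ∈ s, π x * c x with hX
      have hX0 : 0 ≤ X := Finset.sum_nonneg fun x _ => mul_nonneg (hπ x) (hc x)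
      set Y := ∑ x ∈ s, r z x with hY
      have hRY : R = r z B + Y := by rw [hRdef, hW, Finset.sum_insert hBs]
      have hY0 : 0 ≤ Y := Finset.sum_nonneg fun x _ => hr _ _
      have hsum' : ∑ x ∈ s, π x * (c x + κ ^ 2 * (r x z * c z / R))
          = X + κ ^ 2 * (π z * c z * Y / R) := by
        rw [hX, hY, mul_div_assoc, Finset.sum_div, Finset.mul_sum, Finset.mul_sum,
          ← Finset.sum_add_distrib]
        refine Finset.sum_congr rfl fun x _ => ?_
        have := hrev x z
        calc π x * (c x + κ ^ 2 * (r x z * c z / R))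
            = π x * c x + κ ^ 2 * ((π x * r x z) * c z / R) := by ring
          _ = _ := by rw [this]; ring
      rw [hsum'] at hf'π
      set Z := ∑ y ∈ W, (r B y + r B z * r z y / R) * f' y with hZ
      have hZ1 : ∑ y ∈ W, r B y * f' y + κ ^ 2 * (r B z * ∑ y ∈ W, r z y * f' y / R)
          ≤ κ ^ 2 * Z := by
        have : Z = ∑ y ∈ W, r B y * f' y + r B z * ∑ y ∈ W, r z y * f' y / R := by
          rw [hZ, Finset.mul_sum, ← Finset.sum_add_distrib]
          exact Finset.sum_congr rfl fun y _ => by ring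
        rw [this, mul_add]
        have h0 : 0 ≤ ∑ y ∈ W, r B y * f' y :=
          Finset.sum_nonneg fun y _ => mul_nonneg (hr _ _) (hf'0 y)
        nlinarith
      have hT0 : 0 ≤ π z * c z / R := div_nonneg (mul_nonneg (hπ _) (hc _)) hR.le
      have hrzB := hr z B
      calc π B * (r B z * F p + ∑ y ∈ W, r B y * f' y)
          ≤ π B * (r B z * (κ * (c z / R) + κ ^ 2 * ∑ y ∈ W, r z y * f' y / R)
              + ∑ y ∈ W, r B y * f' y) := by
            gcongr
            · exact hπ B
            · exact hr _ _
        _ = π B * (∑ y ∈ W, r B y * f' y + κ ^ 2 * (r B z * ∑ y ∈ W, r z y * f' y / R))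
              + κ * ((π B * r B z) * c z / R) := by ring
        _ ≤ π B * (κ ^ 2 * Z) + κ * ((π B * r B z) * c z / R) := by
            gcongr
            exact hπ B
        _ = κ ^ 2 * (π B * Z) + κ * (π z * c z / R * r z B) := by rw [hrev B z]; ring
        _ ≤ κ ^ 2 * ((κ ^ 3) ^ e * (X + κ ^ 2 * (π z * c z * Y / R)))
              + κ ^ 4 * (κ ^ 3) ^ e * (π z * c z / R * r z B) := by
            apply add_le_add (mul_le_mul_of_nonneg_left hf'π (by positivity))
            apply mul_le_mul_of_nonneg_right _ (mul_nonneg hT0 hrzB)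
            calc κ = κ ^ 1 * 1 := by ring
              _ ≤ κ ^ 4 * (κ ^ 3) ^ e :=
                mul_le_mul (pow_le_pow_right₀ hκ (by norm_num)) hκe zero_le_one (by positivity)
        _ ≤ κ ^ 4 * (κ ^ 3) ^ e * (X + π z * c z * Y / R)
              + κ ^ 4 * (κ ^ 3) ^ e * (π z * c z / R * r z B) := by
            refine add_le_add_left ?_ _
            have : X ≤ κ ^ 2 * X := le_mul_of_one_le_left hX0 hκ2
            calc κ ^ 2 * ((κ ^ 3) ^ e * (X + κ ^ 2 * (π z * c z * Y / R)))
                ≤ κ ^ 2 * ((κ ^ 3) ^ e * (κ ^ 2 * X + κ ^ 2 * (π z * c z * Y / R))) := by gcongr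
              _ = _ := by ring
        _ = κ ^ (4 + 3 * e) * (π z * c z + X) := by
            rw [pow_add, pow_mul]
            -- The cost at `z` splits according to whether `z` is left for `B` or for `s`.
            have : π z * c z = π z * c z / R * r z B + π z * c z * Y / R := by
              rw [hRY] at hR ⊢; field_simp
            linear_combination (-(κ ^ 4 * (κ ^ 3) ^ e)) * this

/-! ### From Lyapunov functions to concentration of an inhomogeneous chain -/

section Chain

variable {S : Type*} [Fintype S] [DecidableEq S]

theorem transition_add (Q : ℕ → Matrix S S ℝ) (m k n : ℕ) :
    transition Q m (k + n) = transition Q m k * transition Q (m + k) n := by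
  induction n with
  | zero => simp [transition]
  | succ n ih => rw [← add_assoc, transition, ih, transition, Matrix.mul_assoc, add_assoc]

theorem transition_nonneg {Q : ℕ → Matrix S S ℝ} (hQ0 : ∀ t x y, 0 ≤ Q t x y) (m n : ℕ) (x y : S) :
    0 ≤ transition Q m n x y := by
  induction n generalizing y with
  | zero => simp only [transition, Matrix.one_apply]; split_ifs <;> norm_num
  | succ n ih =>
    rw [transition, Matrix.mul_apply]
    exact Finset.sum_nonneg fun z _ => mul_nonneg (ih z) (hQ0 _ _ _)

theorem transition_rowsum {Q : ℕ → Matrix S S ℝ} (hQ1 : ∀ t x, ∑ y, Q t x y = 1) (m n : ℕ) (x : S) :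
    ∑ y, transition Q m n x y = 1 := by
  induction n with
  | zero => simp [transition, Matrix.one_apply]
  | succ n ih =>
    simp_rw [transition, Matrix.mul_apply]
    rw [Finset.sum_comm]
    simp_rw [← Finset.mul_sum, hQ1, mul_one, ih]

/-- Transitions preserve distributions. -/
theorem vecMul_transition_mem_stdSimplex {Q : ℕ → Matrix S S ℝ} (hQ0 : ∀ t x y, 0 ≤ Q t x y)
    (hQ1 : ∀ t x, ∑ y, Q t x y = 1) (m n : ℕ) {μ : S → ℝ} (hμ : μ ∈ stdSimplex ℝ S) :
    Matrix.vecMul μ (transition Q m n) ∈ stdSimplex ℝ S := by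
  refine ⟨fun y => ?_, ?_⟩
  · exact Finset.sum_nonneg fun x _ => mul_nonneg (hμ.1 x) (transition_nonneg hQ0 m n x y)
  · simp_rw [Matrix.vecMul, dotProduct]
    rw [Finset.sum_comm]
    simp_rw [← Finset.mul_sum, transition_rowsum hQ1, mul_one]
    exact hμ.2

/-- The space-time supersolution for being away from the target at the final time. -/
noncomputable def awayBound (f : S → ℝ) (η : ℝ) (n : ℕ) (x : S) : ℝ :=
  min 1 (f x / n) + η * ∑ i ∈ Finset.range (n - 1), ((i : ℝ) + 1)⁻¹

/-- Off `B`, the unit decrease of `f` pays for one more step in the denominator of `f / n`. At `B`,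
where `f` may increase by η, the new summand η/n of the harmonic sum pays. -/
theorem mulVec_awayBound_le {q : Matrix S S ℝ} (hq0 : ∀ x y, 0 ≤ q x y) (hq1 : ∀ x, ∑ y, q x y = 1)
    {B : S} {f : S → ℝ} {η : ℝ} (hη : 0 ≤ η) (hf0 : ∀ x, 0 ≤ f x)
    (hf : ∀ x, x ≠ B → ∑ y, q x y * f y ≤ f x - 1) (hfη : ∑ y, q B y * f y ≤ η)
    {n : ℕ} (hn : 1 ≤ n) (x : S) :
    ∑ y, q x y * awayBound f η n y ≤ awayBound f η (n + 1) x := by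
  have hnpos : (0 : ℝ) < n := by exact_mod_cast hn
  have hsplit : ∑ y, q x y * awayBound f η n y
      = ∑ y, q x y * min 1 (f y / n) + η * ∑ i ∈ Finset.range (n - 1), ((i : ℝ) + 1)⁻¹ := by
    simp_rw [awayBound, mul_add, Finset.sum_add_distrib, ← Finset.sum_mul, hq1, one_mul]
  have hmin1 : ∑ y, q x y * min 1 (f y / n) ≤ 1 := by
    refine le_trans ?_ (hq1 x).le
    exact Finset.sum_le_sum fun y _ => mul_le_of_le_one_right (hq0 x y) (min_le_left _ _)
  have hmin2 : ∑ y, q x y * min 1 (f y / n) ≤ (∑ y, q x y * f y) / n := by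
    rw [Finset.sum_div]
    refine Finset.sum_le_sum fun y _ => ?_
    rw [mul_div_assoc]
    exact mul_le_mul_of_nonneg_left (min_le_right _ _) (hq0 x y)
  have hrange : ∑ i ∈ Finset.range (n + 1 - 1), ((i : ℝ) + 1)⁻¹
      = ∑ i ∈ Finset.range (n - 1), ((i : ℝ) + 1)⁻¹ + (n : ℝ)⁻¹ := by
    obtain ⟨k, rfl⟩ : ∃ k, n = k + 1 := ⟨n - 1, by omega⟩
    simp [Finset.sum_range_succ]
  rw [hsplit, awayBound, hrange, mul_add, add_comm (η * _) (η * (n : ℝ)⁻¹), ← add_assoc]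
  refine add_le_add_left ?_ _
  by_cases hx : x = B
  · subst hx
    have h0 : 0 ≤ min 1 (f x / ((n + 1 : ℕ) : ℝ)) :=
      le_min zero_le_one (div_nonneg (hf0 _) (by positivity))
    have : (∑ y, q x y * f y) / n ≤ η * (n : ℝ)⁻¹ := by
      rw [div_eq_mul_inv]; gcongr
    linarith
  · have h0 : 0 ≤ η * (n : ℝ)⁻¹ := by positivity
    refine le_trans (le_min hmin1 ?_) (le_add_of_nonneg_right h0)
    -- (f − 1)/n ≤ f/(n + 1) holds exactly when f ≤ n + 1; beyond that the truncation at 1 takes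
    -- over.
    by_cases hfx : f x ≤ n + 1
    · refine hmin2.trans ?_
      rw [div_le_div_iff₀ hnpos (by positivity)]
      push_cast
      have := hf x hx
      nlinarith
    · refine hmin1.trans ?_
      rw [le_div_iff₀ (by positivity)]
      push_cast
      linarith

/-- Backward iteration of the one-step bound; the index of `awayBound` is the number of remaining
steps plus an offset `j`, so that it never reaches zero. -/
theorem transition_mulVec_awayBound_le {Q : ℕ → Matrix S S ℝ} (hQ0 : ∀ t x y, 0 ≤ Q t x y)
    (hQ1 : ∀ t x, ∑ y, Q t x y = 1)
    {B : S} {f : S → ℝ} {η : ℝ} (hη : 0 ≤ η) (hf0 : ∀ x, 0 ≤ f x) (u n : ℕ)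
    (hf : ∀ t, u ≤ t → t < u + n → ∀ x, x ≠ B → ∑ y, Q t x y * f y ≤ f x - 1)
    (hfη : ∀ t, u ≤ t → t < u + n → ∑ y, Q t B y * f y ≤ η) (j : ℕ) (hj : 1 ≤ j) (x : S) :
    ∑ y, transition Q u n x y * awayBound f η j y ≤ awayBound f η (n + j) x := by
  induction n generalizing j with
  | zero => simp [transition, Matrix.one_apply]
  | succ n ih =>
    have h1 : ∑ y, transition Q u (n + 1) x y * awayBound f η j y
        = ∑ z, transition Q u n x z * ∑ y, Q (u + n) z y * awayBound f η j y := by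
      simp_rw [transition, Matrix.mul_apply, Finset.sum_mul, Finset.mul_sum]
      rw [Finset.sum_comm]
      simp_rw [mul_assoc]
    rw [h1]
    calc _ ≤ ∑ z, transition Q u n x z * awayBound f η (j + 1) z := by
          refine Finset.sum_le_sum fun z _ =>
            mul_le_mul_of_nonneg_left ?_ (transition_nonneg hQ0 _ _ _ _)
          exact mulVec_awayBound_le (hQ0 _) (hQ1 _) hη hf0 (hf (u + n) (by omega) (by omega))
            (hfη (u + n) (by omega) (by omega)) hj z
      _ ≤ awayBound f η (n + (j + 1)) x :=
          ih (fun t h1 h2 => hf t h1 (by omega)) (fun t h1 h2 => hfη t h1 (by omega)) (j + 1)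
            (by omega)
      _ = _ := by congr 1; omega

/-- A Lyapunov function `f` for the hitting time of `B` that is at most `H`, with drift at most `η`
at `B`, bounds the mass away from `B`. -/
theorem mass_away_le {Q : ℕ → Matrix S S ℝ} (hQ0 : ∀ t x y, 0 ≤ Q t x y)
    (hQ1 : ∀ t x, ∑ y, Q t x y = 1)
    {B : S} {f : S → ℝ} {η H : ℝ} (hη : 0 ≤ η) (hf0 : ∀ x, 0 ≤ f x) (hfH : ∀ x, f x ≤ H)
    (m k n : ℕ) (hn : 0 < n)
    (hf : ∀ t, m + k ≤ t → t < m + k + n → ∀ x, x ≠ B → ∑ y, Q t x y * f y ≤ f x - 1)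
    (hfη : ∀ t, m + k ≤ t → t < m + k + n → ∑ y, Q t B y * f y ≤ η)
    {μ : S → ℝ} (hμ : μ ∈ stdSimplex ℝ S) :
    1 - Matrix.vecMul μ (transition Q m (k + n)) B ≤ H / n + η * (1 + Real.log n) := by
  have hf1 : ∀ x, x ≠ B → 1 ≤ f x := fun x hx => by
    have h1 := hf (m + k) le_rfl (by omega) x hx
    have h2 : 0 ≤ ∑ y, Q (m + k) x y * f y :=
      Finset.sum_nonneg fun y _ => mul_nonneg (hQ0 _ _ _) (hf0 y)
    linarith
  have hH0 : 0 ≤ H := (hf0 B).trans (hfH B)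
  set ν := Matrix.vecMul μ (transition Q m k) with hν
  have hνs : ν ∈ stdSimplex ℝ S := vecMul_transition_mem_stdSimplex hQ0 hQ1 m k hμ
  have hρs : Matrix.vecMul μ (transition Q m (k + n)) ∈ stdSimplex ℝ S :=
    vecMul_transition_mem_stdSimplex hQ0 hQ1 m (k + n) hμ
  set ρ := Matrix.vecMul μ (transition Q m (k + n)) with hρ
  have hρν : ρ = Matrix.vecMul ν (transition Q (m + k) n) := by
    rw [hρ, transition_add, hν, Matrix.vecMul_vecMul]
  have hharm : ∑ i ∈ Finset.range n, ((i : ℝ) + 1)⁻¹ ≤ 1 + Real.log n := by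
    have := harmonic_le_one_add_log n
    simpa [harmonic] using this
  have hbound : ∀ x, awayBound f η (n + 1) x ≤ H / n + η * (1 + Real.log n) := fun x => by
    rw [awayBound]
    refine add_le_add ((min_le_right _ _).trans ?_)
      (mul_le_mul_of_nonneg_left (by simpa using hharm) hη)
    exact div_le_div₀ hH0 (hfH x) (by exact_mod_cast hn) (by push_cast; linarith)
  -- At index 1 the harmonic sum is empty, and `f ≥ 1` off `B` because a nonnegative `f` decreases
  -- there by one.
  have h1 : ∀ y, (if y = B then 0 else 1) ≤ awayBound f η 1 y := fun y => by
    simp only [awayBound, Nat.cast_one, div_one, Nat.sub_self, Finset.range_zero, Finset.sum_empty,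
      mul_zero, add_zero]
    split_ifs with hy
    · exact le_min zero_le_one (hf0 y)
    · exact le_min le_rfl (hf1 y hy)
  calc 1 - ρ B = ∑ y, ρ y * (if y = B then 0 else 1) := by
        have := hρs.2
        have h2 : ∀ y, ρ y * (if y = B then 0 else 1) = ρ y - if y = B then ρ y else 0 :=
          fun y => by split_ifs <;> ring
        simp_rw [h2, Finset.sum_sub_distrib, this]
        simp
    _ ≤ ∑ y, ρ y * awayBound f η 1 y :=
        Finset.sum_le_sum fun y _ => mul_le_mul_of_nonneg_left (h1 y) (hρs.1 y)
    _ = ∑ x, ν x * ∑ y, transition Q (m + k) n x y * awayBound f η 1 y := by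
        simp_rw [hρν, Matrix.vecMul, dotProduct, Finset.sum_mul, Finset.mul_sum]
        rw [Finset.sum_comm]
        simp_rw [mul_assoc]
    _ ≤ ∑ x, ν x * (H / n + η * (1 + Real.log n)) :=
        Finset.sum_le_sum fun x _ => mul_le_mul_of_nonneg_left
          ((transition_mulVec_awayBound_le hQ0 hQ1 hη hf0 _ n hf hfη 1 le_rfl x).trans (hbound x))
          (hνs.1 x)
    _ = _ := by rw [← Finset.sum_mul, hνs.2, one_mul]

theorem tvDist_single {μ : S → ℝ} (hμ : μ ∈ stdSimplex ℝ S) (B : S) :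
    tvDist μ (Pi.single B 1) = 1 - μ B := by
  have h2 := hμ.2
  have h3 : μ B ≤ 1 := by
    rw [← h2]; exact Finset.single_le_sum (fun y _ => hμ.1 y) (Finset.mem_univ B)
  rw [tvDist]
  rw [← Finset.add_sum_erase _ _ (Finset.mem_univ B)] at h2 ⊢
  rw [Finset.sum_congr rfl (g := μ)]
  · rw [Pi.single_eq_same, abs_of_nonpos (by linarith)]; linarith
  · intro y hy
    rw [Pi.single_eq_of_ne (Finset.ne_of_mem_erase hy), sub_zero, abs_of_nonneg (hμ.1 y)]

/-- Concentration at `B` from Lyapunov functions on the time windows `[T - T / 2, T)`. -/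
theorem stronglyErgodicTo_single {Q : ℕ → Matrix S S ℝ} (hQ0 : ∀ t x y, 0 ≤ Q t x y)
    (hQ1 : ∀ t x, ∑ y, Q t x y = 1) (B : S) (η H : ℕ → ℝ) (hη0 : ∀ T, 0 ≤ η T)
    (hη : Tendsto (fun T : ℕ => η T * (1 + Real.log T)) atTop (𝓝 0))
    (hH : Tendsto (fun T : ℕ => H T / T) atTop (𝓝 0))
    (hf : ∀ᶠ T in atTop, ∃ f : S → ℝ, (∀ x, 0 ≤ f x) ∧ (∀ x, f x ≤ H T) ∧
      ∀ t, T ≤ 2 * (t + 1) → t < T →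
        (∀ x, x ≠ B → ∑ y, Q t x y * f y ≤ f x - 1) ∧ ∑ y, Q t B y * f y ≤ η T) :
    StronglyErgodicTo Q (Pi.single B 1) := by
  refine ⟨single_mem_stdSimplex ℝ B, fun m => ?_⟩
  have hlim : Tendsto (fun T : ℕ => 3 * (H T / T) + η T * (1 + Real.log T)) atTop (𝓝 0) := by
    simpa using (hH.const_mul 3).add hη
  have hlim' := hlim.comp (tendsto_add_atTop_nat m)
  have hnn : ∀ n, ∀ μ : stdSimplex ℝ S,
      0 ≤ tvDist (Matrix.vecMul (μ : S → ℝ) (transition Q m n)) (Pi.single B 1) := fun n μ =>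
    mul_nonneg (by norm_num) (Finset.sum_nonneg fun _ _ => abs_nonneg _)
  refine squeeze_zero' (Eventually.of_forall fun n => Real.iSup_nonneg (hnn n)) ?_ hlim'
  have hf' := (tendsto_add_atTop_nat m).eventually hf
  filter_upwards [hf', eventually_ge_atTop (m + 2)] with n hn hnm
  obtain ⟨f, hf0, hfH, hfQ⟩ := hn
  have : Nonempty (stdSimplex ℝ S) := ⟨⟨_, single_mem_stdSimplex ℝ B⟩⟩
  refine ciSup_le fun μ => ?_
  have hμ : (μ : S → ℝ) ∈ stdSimplex ℝ S := μ.2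
  rw [tvDist_single (vecMul_transition_mem_stdSimplex hQ0 hQ1 m n hμ)]
  -- `T` is the absolute final time; the first `k` steps only serve to reach the window of the last
  -- `T / 2` steps.
  set T := n + m with hT
  obtain ⟨k, hk⟩ : ∃ k, n = k + T / 2 := ⟨n - T / 2, by omega⟩
  have hpos : 0 < T / 2 := by omega
  have h3 : (T : ℝ) ≤ 3 * ((T / 2 : ℕ) : ℝ) := by
    have : T ≤ 3 * (T / 2) := by omega
    exact_mod_cast this
  have hposR : (0 : ℝ) < ((T / 2 : ℕ) : ℝ) := by exact_mod_cast hpos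
  have hTpos : (0 : ℝ) < T := by
    have : 0 < T := by omega
    exact_mod_cast this
  have hle : ((T / 2 : ℕ) : ℝ) ≤ T := by exact_mod_cast Nat.div_le_self _ _
  have hH0 : 0 ≤ H T := (hf0 B).trans (hfH B)
  have key := mass_away_le hQ0 hQ1 (hη0 T) hf0 hfH m k (T / 2) hpos
    (fun t h1 h2 => (hfQ t (by omega) (by omega)).1)
    (fun t h1 h2 => (hfQ t (by omega) (by omega)).2) hμ
  rw [← hk] at key
  refine key.trans (add_le_add ?_ (mul_le_mul_of_nonneg_left ?_ (hη0 T)))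
  · rw [mul_div_assoc', div_le_div_iff₀ hposR hTpos]
    nlinarith
  · gcongr

/-- An explicit Lyapunov function for the hitting time of the zero set of a rank `d` that never
increases by more than one in a step and decreases with probability at least `p`. -/
theorem rank_lyapunov {q : Matrix S S ℝ} (hq0 : ∀ x y, 0 ≤ q x y) (hq1 : ∀ x, ∑ y, q x y = 1)
    (d : S → ℕ) (N : ℕ) (hdN : ∀ x, d x ≤ N) (hstep : ∀ x y, q x y ≠ 0 → d y ≤ d x + 1)
    {p : ℝ} (hp0 : 0 < p) (hp1 : p ≤ 1) (x : S) (hx : ∃ y, d y < d x ∧ p ≤ q x y) :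
    ∑ y, q x y * ∑ i ∈ Finset.range (d y), (2 / p) ^ (N - i)
      ≤ ∑ i ∈ Finset.range (d x), (2 / p) ^ (N - i) - 1 := by
  set G : ℕ → ℝ := fun n => ∑ i ∈ Finset.range n, (2 / p) ^ (N - i) with hG
  have h2p : 1 ≤ 2 / p := by rw [le_div_iff₀ hp0]; linarith
  have hmono : Monotone G := fun a b hab =>
    Finset.sum_le_sum_of_subset_of_nonneg (Finset.range_mono hab) fun _ _ _ => by positivity
  -- `b` is the cost of going up one rank. Going down gains at least `2 / p * b` with probability at
  -- least `p`, so the net drift is at most b − 2b ≤ −1.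
  set b := (2 / p) ^ (N - d x) with hb
  have hb1 : 1 ≤ b := one_le_pow₀ h2p
  obtain ⟨y₀, hy₀, hpy₀⟩ := hx
  have hup : ∀ y, q x y * (G (d y) - G (d x)) ≤ q x y * b := fun y => by
    by_cases hq : q x y = 0
    · simp [hq]
    · refine mul_le_mul_of_nonneg_left ?_ (hq0 x y)
      have := hmono (hstep x y hq)
      simp only [hG, Finset.sum_range_succ] at this ⊢
      linarith
  have hdown : G (d y₀) - G (d x) ≤ -(2 / p * b) := by
    obtain ⟨k, hk⟩ : ∃ k, d x = k + 1 := ⟨d x - 1, by omega⟩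
    have h1 := hmono (show d y₀ ≤ k by omega)
    have h2 : G (d x) = G k + 2 / p * b := by
      simp only [hG, hk, Finset.sum_range_succ, hb]
      rw [← pow_succ', show N - k = N - (k + 1) + 1 by have := hdN x; omega]
    linarith
  have hsum : ∑ y, q x y * G (d y) - G (d x) = ∑ y, q x y * (G (d y) - G (d x)) := by
    simp_rw [mul_sub, Finset.sum_sub_distrib, ← Finset.sum_mul, hq1, one_mul]
  have hle : ∑ y, q x y * (G (d y) - G (d x)) ≤ -1 := by
    rw [← Finset.add_sum_erase _ _ (Finset.mem_univ y₀)]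
    have h1 : ∑ y ∈ Finset.univ.erase y₀, q x y * (G (d y) - G (d x)) ≤ b := by
      calc _ ≤ ∑ y ∈ Finset.univ.erase y₀, q x y * b := Finset.sum_le_sum fun y _ => hup y
        _ ≤ ∑ y, q x y * b := Finset.sum_le_sum_of_subset_of_nonneg (Finset.erase_subset _ _)
            fun y _ _ => mul_nonneg (hq0 x y) (by linarith)
        _ = b := by rw [← Finset.sum_mul, hq1, one_mul]
    have h2 : q x y₀ * (G (d y₀) - G (d x)) ≤ -(2 * b) := by
      have hpos : 0 < 2 / p * b := by positivity
      have : p * (2 / p * b) = 2 * b := by field_simp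
      nlinarith
    linarith
  linarith

end Chain

/-! ### Gibbs kernels, annealing windows and the learning chain -/

section Gibbs

variable {M N K : ℕ}

theorem AgreeOff.symm {j : Fin N} {A B : Config M N K} (h : AgreeOff j A B) : AgreeOff j B A :=
  fun k hk i => (h k hk i).symm

theorem AgreeOff.trans {j : Fin N} {A B C : Config M N K} (h : AgreeOff j A B)
    (h' : AgreeOff j B C) : AgreeOff j A C :=
  fun k hk i => (h k hk i).trans (h' k hk i)

open Classical in
theorem gibbs_denom_pos (β : ℝ) (H : Config M N K → ℝ) (j : Fin N) (B : Config M N K) :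
    0 < ∑ A' : Config M N K, if AgreeOff j A' B then Real.exp (β * H A') else 0 :=
  Finset.sum_pos' (fun A _ => by split_ifs <;> positivity)
    ⟨B, Finset.mem_univ _, by
      rw [if_pos (show AgreeOff j B B from fun _ _ _ => rfl)]; positivity⟩

theorem gibbsCond_nonneg (β : ℝ) (H : Config M N K → ℝ) (j : Fin N) (B A : Config M N K) :
    0 ≤ gibbsCond β H j B A := by
  rw [gibbsCond]
  split_ifs
  · exact div_nonneg (Real.exp_pos _).le (gibbs_denom_pos β H j B).le
  · exact le_rfl

theorem sum_gibbsCond (β : ℝ) (H : Config M N K → ℝ) (j : Fin N) (B : Config M N K) :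
    ∑ A, gibbsCond β H j B A = 1 := by
  classical
  rw [← div_self (gibbs_denom_pos β H j B).ne', Finset.sum_div]
  refine Finset.sum_congr rfl fun A _ => ?_
  rw [gibbsCond]
  split_ifs <;> simp

/-- Detailed balance. -/
theorem gibbsCond_reversible (β : ℝ) (H : Config M N K → ℝ) (j : Fin N) (A B : Config M N K) :
    Real.exp (β * H A) * gibbsCond β H j A B = Real.exp (β * H B) * gibbsCond β H j B A := by
  classical
  by_cases h : AgreeOff j A B
  · have hsum : (∑ C : Config M N K, if AgreeOff j C A then Real.exp (β * H C) else 0)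
        = ∑ C : Config M N K, if AgreeOff j C B then Real.exp (β * H C) else 0 :=
      Finset.sum_congr rfl fun C _ =>
        if_congr ⟨fun hc => hc.trans h, fun hc => hc.trans h.symm⟩ rfl rfl
    rw [gibbsCond, gibbsCond, if_pos h, if_pos h.symm]
    rw [show (∑ C : Config M N K, @ite _ (AgreeOff j C A) (Classical.propDecidable _)
      (Real.exp (β * H C)) 0) = _ by convert hsum]
    ring
  · have h' : ¬ AgreeOff j B A := fun hc => h hc.symm
    simp [gibbsCond, h, h']

/-- The Boltzmann weight and the normalizing sum each contribute a factor exp δ. -/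
theorem gibbsCond_le_mul {β β' δ : ℝ} {H H' : Config M N K → ℝ}
    (hδ : ∀ A, |β * H A - β' * H' A| ≤ δ) (j : Fin N) (B A : Config M N K) :
    gibbsCond β H j B A ≤ Real.exp (2 * δ) * gibbsCond β' H' j B A := by
  classical
  have h1 : ∀ A, Real.exp (β * H A) ≤ Real.exp δ * Real.exp (β' * H' A) := fun A => by
    rw [← Real.exp_add]; exact Real.exp_le_exp.2 (by linarith [(abs_le.1 (hδ A)).2])
  have h2 : ∀ A, Real.exp (β' * H' A) ≤ Real.exp δ * Real.exp (β * H A) := fun A => by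
    rw [← Real.exp_add]; exact Real.exp_le_exp.2 (by linarith [(abs_le.1 (hδ A)).1])
  rw [gibbsCond, gibbsCond]
  split_ifs with h
  · have hD := gibbs_denom_pos β H j B
    have hD' := gibbs_denom_pos β' H' j B
    have hle : (∑ A' : Config M N K, if AgreeOff j A' B then Real.exp (β' * H' A') else 0)
        ≤ Real.exp δ * ∑ A' : Config M N K, if AgreeOff j A' B then Real.exp (β * H A') else 0 := by
      rw [Finset.mul_sum]
      refine Finset.sum_le_sum fun A' _ => ?_
      split_ifs
      · exact h2 A'
      · simp
    rw [mul_div_assoc', div_le_div_iff₀ hD hD', two_mul, Real.exp_add]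
    calc _ ≤ (Real.exp δ * Real.exp (β' * H' A)) * (Real.exp δ *
          ∑ A' : Config M N K, if AgreeOff j A' B then Real.exp (β * H A') else 0) :=
          mul_le_mul (h1 A) hle hD'.le (by positivity)
      _ = _ := by ring
  · simp

theorem le_gibbsCond {β δ : ℝ} {H : Config M N K → ℝ} {j : Fin N} {A B : Config M N K}
    (hAB : AgreeOff j A B) (hδ : ∀ C, β * H C - β * H A ≤ δ) :
    1 / (Fintype.card (Config M N K) : ℝ) * Real.exp (-δ) ≤ gibbsCond β H j B A := by
  classical
  have : Nonempty (Config M N K) := ⟨A⟩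
  have hc : (0 : ℝ) < Fintype.card (Config M N K) := by exact_mod_cast Fintype.card_pos
  rw [gibbsCond, if_pos hAB, le_div_iff₀ (gibbs_denom_pos β H j B)]
  have hle : (∑ A' : Config M N K, if AgreeOff j A' B then Real.exp (β * H A') else 0)
      ≤ Fintype.card (Config M N K) * Real.exp (δ + β * H A) := by
    rw [← nsmul_eq_mul, ← Finset.card_univ]
    refine Finset.sum_le_card_nsmul _ _ _ fun C _ => ?_
    split_ifs
    · exact Real.exp_le_exp.2 (by linarith [hδ C])
    · positivity
  calc _ ≤ 1 / (Fintype.card (Config M N K) : ℝ) * Real.exp (-δ) *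
        (Fintype.card (Config M N K) * Real.exp (δ + β * H A)) := by gcongr
    _ = Real.exp (-δ) * Real.exp (δ + β * H A) := by field_simp
    _ = Real.exp (β * H A) := by rw [← Real.exp_add]; congr 1; ring

theorem learningTPM_nonneg (β₀ : ℝ) (θ : Fin N → Fin M → Finset (Fin N) → ℕ → ℝ) (t : ℕ)
    (x y : Config M N K) : 0 ≤ learningTPM K β₀ θ t x y := by
  simp only [learningTPM, Matrix.of_apply]
  exact Finset.sum_nonneg fun _ _ => mul_nonneg (by positivity) (gibbsCond_nonneg _ _ _ _ _)

theorem sum_learningTPM (hN : 0 < N) (β₀ : ℝ) (θ : Fin N → Fin M → Finset (Fin N) → ℕ → ℝ)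
    (t : ℕ) (x : Config M N K) : ∑ y, learningTPM K β₀ θ t x y = 1 := by
  have hN' : (N : ℝ) ≠ 0 := by exact_mod_cast hN.ne'
  simp only [learningTPM, Matrix.of_apply]
  rw [Finset.sum_comm]
  simp_rw [← Finset.mul_sum, sum_gibbsCond]
  simp [hN']

/-- The number of columns in which a placement differs from `B`. -/
def columnDist (B x : Config M N K) : ℕ :=
  (Finset.univ.filter fun j => ∃ i, x.1 i j ≠ B.1 i j).card

theorem columnDist_le (B x : Config M N K) : columnDist B x ≤ N :=
  (Finset.card_le_univ _).trans_eq (Fintype.card_fin N)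

theorem columnDist_le_succ {B x y : Config M N K} {k : Fin N} (h : AgreeOff k y x) :
    columnDist B y ≤ columnDist B x + 1 := by
  refine le_trans (Finset.card_le_card ?_) (Finset.card_insert_le k _)
  intro j hj
  by_cases hjk : j = k
  · simp [hjk]
  · simp only [Finset.mem_filter, Finset.mem_univ, true_and, Finset.mem_insert] at hj ⊢
    obtain ⟨i, hi⟩ := hj
    exact Or.inr ⟨i, by rwa [← h j hjk i]⟩

/-- Copying a wrong column from `B` is a single-station move and stays feasible, since the
constraint is imposed column by column. Hence `B` is reached in at most `N` moves. -/
theorem exists_columnDist_lt {B x : Config M N K} (h : x ≠ B) :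
    ∃ (k : Fin N) (y : Config M N K), AgreeOff k y x ∧ columnDist B y < columnDist B x := by
  obtain ⟨i, k, hik⟩ : ∃ i k, x.1 i k ≠ B.1 i k := by
    by_contra hcon
    push Not at hcon
    exact h (Subtype.ext (by ext i j; rw [hcon i j]))
  refine ⟨k, ⟨fun i j => if j = k then B.1 i j else x.1 i j, fun j => ?_⟩, fun j hj i => ?_, ?_⟩
  · by_cases hj : j = k
    · simpa [hj] using B.2 k
    · simpa [hj] using x.2 j
  · simp [hj]
  · refine Finset.card_lt_card ⟨fun j hj => ?_, fun hsub => ?_⟩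
    · simp only [Finset.mem_filter, Finset.mem_univ, true_and] at hj ⊢
      obtain ⟨l, hl⟩ := hj
      by_cases hjk : j = k
      · simp [hjk] at hl
      · exact ⟨l, by simpa [hjk] using hl⟩
    · have hk : k ∈ Finset.univ.filter fun j => ∃ i, x.1 i j ≠ B.1 i j := by
        simpa using ⟨i, hik⟩
      simpa using hsub hk

/-- With a logarithmic schedule, halving the time changes the inverse temperature only by a bounded
amount. -/
theorem invTemp_le_and_sub_le {β₀ : ℝ} (hβ₀ : 0 < β₀) (hN : 0 < N) {T u : ℕ} (h : T ≤ 2 * u)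
    (h' : u ≤ T) :
    invTemp N β₀ u ≤ invTemp N β₀ T ∧ invTemp N β₀ T - invTemp N β₀ u ≤ β₀ * Real.log 2 := by
  have h1 : u / N ≤ T / N := Nat.div_le_div_right h'
  have h2 : T / N ≤ 2 * (u / N) + 1 := by
    rw [← Nat.lt_succ_iff, Nat.div_lt_iff_lt_mul hN]
    have := Nat.lt_mul_div_succ u hN
    nlinarith
  have h1' : ((u / N : ℕ) : ℝ) ≤ ((T / N : ℕ) : ℝ) := by exact_mod_cast h1
  have h2' : ((T / N : ℕ) : ℝ) ≤ 2 * ((u / N : ℕ) : ℝ) + 1 := by exact_mod_cast h2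
  have h0 : (0 : ℝ) ≤ ((u / N : ℕ) : ℝ) := Nat.cast_nonneg _
  constructor
  · unfold invTemp; gcongr
  · rw [invTemp, invTemp, ← mul_sub]
    refine mul_le_mul_of_nonneg_left ?_ hβ₀.le
    rw [sub_le_iff_le_add, ← Real.log_mul (by norm_num) (by positivity)]
    exact Real.log_le_log (by positivity) (by linarith)

theorem tendsto_log_index (hN : 0 < N) :
    Tendsto (fun T : ℕ => Real.log (1 + ((T / N : ℕ) : ℝ))) atTop atTop :=
  Real.tendsto_log_atTop.comp (tendsto_atTop_add_const_left _ _
    (tendsto_natCast_atTop_atTop.comp (Nat.tendsto_div_const_atTop hN.ne')))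

theorem tendsto_invTemp {β₀ : ℝ} (hβ₀ : 0 < β₀) (hN : 0 < N) :
    Tendsto (invTemp N β₀) atTop atTop :=
  (tendsto_log_index hN).const_mul_atTop hβ₀

/-- On the windows `[T / 2, T]` the exponents used by all stations are `ε β_T`-close to
`β_T h`. -/
theorem eventually_exponent_close {S : Type*} [Finite S] {β₀ : ℝ} (hβ₀ : 0 < β₀) (hN : 0 < N)
    (h : S → ℝ) (g : Fin N → ℕ → S → ℝ)
    (hg : ∀ k A, Tendsto (fun t => g k t A) atTop (𝓝 (h A))) {ε : ℝ} (hε : 0 < ε) :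
    ∀ᶠ T in atTop, ∀ u, T ≤ 2 * u → u ≤ T → ∀ k A,
      |invTemp N β₀ u * g k u A - invTemp N β₀ T * h A| ≤ ε * invTemp N β₀ T := by
  have hev : ∀ᶠ u in atTop, ∀ k A, |g k u A - h A| ≤ ε / 2 := by
    rw [eventually_all]; intro k
    rw [eventually_all]; intro A
    filter_upwards [(Metric.tendsto_nhds.1 (hg k A)) (ε / 2) (by positivity)] with u hu
    exact hu.le
  obtain ⟨U, hU⟩ := eventually_atTop.1 hev
  obtain ⟨C, hC⟩ : ∃ C, ∀ A, |h A| ≤ C := by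
    obtain ⟨C, hC⟩ := (Set.finite_range fun A => |h A|).bddAbove
    exact ⟨C, fun A => hC ⟨A, rfl⟩⟩
  filter_upwards [eventually_ge_atTop (2 * U),
    (tendsto_invTemp hβ₀ hN).eventually_ge_atTop (2 * (β₀ * Real.log 2 * C) / ε)]
    with T hT hT' u hu1 hu2 k A
  obtain ⟨h1, h2⟩ := invTemp_le_and_sub_le hβ₀ hN hu1 hu2
  have h3 := hU u (by omega) k A
  have h0 : 0 ≤ invTemp N β₀ u := mul_nonneg hβ₀.le (Real.log_nonneg (by simp))
  have hlog : 0 ≤ β₀ * Real.log 2 := mul_nonneg hβ₀.le (Real.log_nonneg (by norm_num))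
  rw [div_le_iff₀ hε] at hT'
  calc |invTemp N β₀ u * g k u A - invTemp N β₀ T * h A|
      = |invTemp N β₀ u * (g k u A - h A) - (invTemp N β₀ T - invTemp N β₀ u) * h A| := by
        congr 1; ring
    _ ≤ |invTemp N β₀ u * (g k u A - h A)| + |(invTemp N β₀ T - invTemp N β₀ u) * h A| :=
        abs_sub _ _
    _ ≤ invTemp N β₀ T * (ε / 2) + β₀ * Real.log 2 * C := by
        rw [abs_mul, abs_mul, abs_of_nonneg h0, abs_of_nonneg (sub_nonneg.2 h1)]
        exact add_le_add (mul_le_mul h1 h3 (abs_nonneg _) (h0.trans h1))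
          (mul_le_mul h2 (hC A) (abs_nonneg _) hlog)
    _ ≤ _ := by linarith

/-- The learning chain concentrates at the unique maximizer `B` of `h` when the estimated hit rates
converge to `h`. On each window `[T / 2, T]` the minimum of two Lyapunov functions for the hitting
time of `B` is used: a robust one with small drift at `B`, and an explicit one of size `o(T)`. -/
theorem stronglyErgodicTo_learningTPM (hN : 0 < N) (h : Config M N K → ℝ) (B : Config M N K)
    {γ Δ β₀ : ℝ} (hγ0 : 0 < γ) (hγ : ∀ x, x ≠ B → h x + γ ≤ h B) (hΔ : ∀ x y, h x - h y ≤ Δ)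
    (hβ₀ : 0 < β₀) (hβΔ : β₀ * N * Δ < 1) (θ : Fin N → Fin M → Finset (Fin N) → ℕ → ℝ)
    (hθ : ∀ k A, Tendsto (fun t => hitRate (fun i s => θ k i s t) A) atTop (𝓝 (h A))) :
    StronglyErgodicTo (learningTPM K β₀ θ) (Pi.single B 1) := by
  classical
  obtain ⟨e, he⟩ := exists_robust_lyapunov B (columnDist B) (Finset.univ.erase B)
    (Finset.notMem_erase _ _)
  rw [Finset.insert_erase (Finset.mem_univ B)] at he
  have hNR : (0 : ℝ) < N := by exact_mod_cast hN
  have hΔ0 : 0 ≤ Δ := by simpa using hΔ B B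
  -- The first bound lets κ^(e + 1) consume at most half of the gap γ; the second keeps the exponent
  -- ρ below 1.
  set ε := min (γ / (4 * (e + 1))) ((1 - β₀ * N * Δ) / (4 * (β₀ * N))) with hεdef
  have hε : 0 < ε := lt_min (by positivity) (div_pos (by linarith) (by positivity))
  have hε1 : 2 * ε * (e + 1) ≤ γ / 2 := by
    have : ε ≤ γ / (4 * (e + 1)) := min_le_left _ _
    rw [le_div_iff₀ (by positivity)] at this
    linarith
  have hε2 : β₀ * N * (Δ + 2 * ε) < 1 := by
    have : ε ≤ (1 - β₀ * N * Δ) / (4 * (β₀ * N)) := min_le_right _ _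
    rw [le_div_iff₀ (by positivity)] at this
    linarith
  have : Nonempty (Config M N K) := ⟨B⟩
  set c : ℝ := (Fintype.card (Config M N K) : ℝ) with hcdef
  have hc : 1 ≤ c := by
    have : 1 ≤ Fintype.card (Config M N K) := Fintype.card_pos
    rw [hcdef]
    exact_mod_cast this
  set b : ℕ → ℝ := invTemp N β₀ with hb
  have hb0 : ∀ T, 0 ≤ b T := fun T => mul_nonneg hβ₀.le (Real.log_nonneg (by simp))
  have hlog := tendsto_log_index hN
  refine stronglyErgodicTo_single (learningTPM_nonneg β₀ θ) (sum_learningTPM hN β₀ θ) B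
    (fun T => c * Real.exp (-(b T * (γ / 2))))
    (fun T => N * (2 * (N * c) * Real.exp (b T * (Δ + 2 * ε))) ^ N)
    (fun T => by positivity) ?_ ?_ ?_
  · have ha : 0 < β₀ * (γ / 2) := by positivity
    have hlim : Tendsto (fun l : ℝ => c * (Real.exp (-(β₀ * (γ / 2) * l)) * (1 + Real.log N)
        + (β₀ * (γ / 2))⁻¹ * ((β₀ * (γ / 2) * l) ^ 1 * Real.exp (-(β₀ * (γ / 2) * l)))))
        atTop (𝓝 0) := by
      have h1 : Tendsto (fun l : ℝ => β₀ * (γ / 2) * l) atTop atTop :=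
        tendsto_id.const_mul_atTop ha
      have h2 := Real.tendsto_exp_neg_atTop_nhds_zero.comp h1
      have h3 := (Real.tendsto_pow_mul_exp_neg_atTop_nhds_zero 1).comp h1
      simpa using ((h2.mul_const (1 + Real.log N)).add (h3.const_mul (β₀ * (γ / 2))⁻¹)).const_mul c
    refine squeeze_zero' ?_ ?_ (hlim.comp hlog)
    · filter_upwards [eventually_ge_atTop 1] with T hT
      have : 0 ≤ Real.log T := Real.log_nonneg (by exact_mod_cast hT)
      positivity
    · filter_upwards [eventually_ge_atTop 1] with T hT
      have hTR : (0 : ℝ) < T := by exact_mod_cast hT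
      have hlogT : Real.log T ≤ Real.log N + Real.log (1 + ((T / N : ℕ) : ℝ)) := by
        rw [← Real.log_mul hNR.ne' (by positivity)]
        refine Real.log_le_log hTR ?_
        have := (Nat.lt_mul_div_succ T hN).le
        rw [add_comm]
        exact_mod_cast this
      simp only [Function.comp, hb, invTemp]
      set l := Real.log (1 + ((T / N : ℕ) : ℝ))
      calc c * Real.exp (-(β₀ * l * (γ / 2))) * (1 + Real.log T)
          ≤ c * Real.exp (-(β₀ * l * (γ / 2))) * (1 + (Real.log N + l)) := by gcongr
        _ = c * (Real.exp (-(β₀ * (γ / 2) * l)) * (1 + Real.log N)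
            + (β₀ * (γ / 2))⁻¹ * ((β₀ * (γ / 2) * l) ^ 1 * Real.exp (-(β₀ * (γ / 2) * l)))) := by
            rw [show β₀ * l * (γ / 2) = β₀ * (γ / 2) * l by ring]
            field_simp
            ring
  · set ρ := β₀ * N * (Δ + 2 * ε) with hρ
    have hlim : Tendsto (fun l : ℝ => 2 * (N * (2 * (N * c)) ^ N) * Real.exp (-((1 - ρ) * l)))
        atTop (𝓝 0) := by
      have h1 : Tendsto (fun l : ℝ => (1 - ρ) * l) atTop atTop :=
        tendsto_id.const_mul_atTop (by linarith)
      simpa using (Real.tendsto_exp_neg_atTop_nhds_zero.comp h1).const_mul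
        (2 * (N * (2 * (N * c)) ^ N))
    -- With `l` the logarithm in the schedule, `H T` is a constant times exp(ρl) = exp(−(1 − ρ)l)
    -- exp l, and exp l ≤ 2T.
    refine squeeze_zero' (Eventually.of_forall fun T => by positivity) ?_ (hlim.comp hlog)
    filter_upwards [eventually_ge_atTop 1] with T hT
    have hTR : (1 : ℝ) ≤ T := by exact_mod_cast hT
    have hL : 1 + ((T / N : ℕ) : ℝ) ≤ 2 * T := by
      have : ((T / N : ℕ) : ℝ) ≤ T := by exact_mod_cast Nat.div_le_self _ _
      linarith
    have hLpos : 0 < 1 + ((T / N : ℕ) : ℝ) := by positivity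
    simp only [Function.comp, hb, invTemp]
    rw [div_le_iff₀ (by linarith)]
    have hexp : Real.exp (Real.log (1 + ((T / N : ℕ) : ℝ))) ≤ 2 * T := by
      rwa [Real.exp_log hLpos]
    set l := Real.log (1 + ((T / N : ℕ) : ℝ))
    calc (N : ℝ) * (2 * (N * c) * Real.exp (β₀ * l * (Δ + 2 * ε))) ^ N
        = N * (2 * (N * c)) ^ N * Real.exp (-((1 - ρ) * l)) * Real.exp l := by
          rw [mul_pow, ← Real.exp_nat_mul, mul_assoc _ (Real.exp _) (Real.exp _), ← Real.exp_add,
            ← mul_assoc]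
          congr 2
          rw [hρ]; ring
      _ ≤ N * (2 * (N * c)) ^ N * Real.exp (-((1 - ρ) * l)) * (2 * T) := by gcongr
      _ = _ := by ring
  · filter_upwards [eventually_exponent_close hβ₀ hN h
      (fun k t A => hitRate (fun i s => θ k i s t) A) hθ hε] with T hT
    set r : Config M N K → Config M N K → ℝ :=
      fun x y => ∑ k : Fin N, (1 / (N : ℝ)) * gibbsCond (b T) h k x y with hr
    set κ := Real.exp (2 * (ε * b T)) with hκdef
    have hκ : 1 ≤ κ := Real.one_le_exp (by have := hb0 T; positivity)
    have hκ0 : 0 < κ := by linarith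
    have hr0 : ∀ x y, 0 ≤ r x y := fun x y =>
      Finset.sum_nonneg fun k _ => mul_nonneg (by positivity) (gibbsCond_nonneg _ _ _ _ _)
    obtain ⟨f, hfB, hf0, hfd, hfη⟩ := he κ r (fun x => Real.exp (b T * h x)) (fun _ => 1) hκ hr0
      (fun x => (Real.exp_pos _).le) (fun _ => zero_le_one)
      (fun x y => by
        simp only [hr, Finset.mul_sum]
        refine Finset.sum_congr rfl fun k _ => ?_
        have := gibbsCond_reversible (b T) h k x y
        linear_combination (1 / (N : ℝ)) * this)
      (fun x hx => by
        obtain ⟨k, y, hky, hdy⟩ := exists_columnDist_lt (Finset.ne_of_mem_erase hx)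
        refine ⟨y, Finset.mem_univ _, hdy, ?_⟩
        refine Finset.sum_pos' (fun k _ => mul_nonneg (by positivity)
          (gibbsCond_nonneg _ _ _ _ _)) ⟨k, Finset.mem_univ _, ?_⟩
        refine mul_pos (by positivity) ?_
        rw [gibbsCond, if_pos hky]
        exact div_pos (Real.exp_pos _) (gibbs_denom_pos _ _ _ _))
    -- Lower bound for a prescribed single-column move: choice of the station, then its Gibbs
    -- weight, where Δ is worsened by an error ε in each of the two compared exponents.
    set p := 1 / (N : ℝ) * (1 / c * Real.exp (-(b T * (Δ + 2 * ε)))) with hp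
    have hp0 : 0 < p := by positivity
    have hNR1 : (1 : ℝ) ≤ N := by exact_mod_cast hN
    have hp1 : p ≤ 1 := by
      have h1 : 1 / (N : ℝ) ≤ 1 := by rw [div_le_one hNR]; exact hNR1
      have h2 : 1 / c ≤ 1 := by rw [div_le_one (by linarith)]; exact hc
      have h3 : Real.exp (-(b T * (Δ + 2 * ε))) ≤ 1 := by
        rw [Real.exp_le_one_iff]
        have := hb0 T
        have : 0 ≤ b T * (Δ + 2 * ε) := by positivity
        linarith
      exact mul_le_one₀ h1 (by positivity) (mul_le_one₀ h2 (by positivity) h3)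
    have h2p : 2 / p = 2 * (N * c) * Real.exp (b T * (Δ + 2 * ε)) := by
      rw [hp, Real.exp_neg]; field_simp
    set g : Config M N K → ℝ := fun x => ∑ i ∈ Finset.range (columnDist B x), (2 / p) ^ (N - i)
      with hg
    have hg0 : ∀ x, 0 ≤ g x := fun x => Finset.sum_nonneg fun i _ => by positivity
    have hgH : ∀ x, g x ≤ N * (2 / p) ^ N := fun x => by
      have h1 : 1 ≤ 2 / p := by rw [le_div_iff₀ hp0]; linarith
      calc g x ≤ columnDist B x • (2 / p) ^ N := by
            have := Finset.sum_le_card_nsmul (Finset.range (columnDist B x))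
              (fun i => (2 / p) ^ (N - i)) ((2 / p) ^ N)
              (fun i _ => pow_le_pow_right₀ h1 (Nat.sub_le _ _))
            simpa using this
        _ ≤ N * (2 / p) ^ N := by
            rw [nsmul_eq_mul]
            have : (columnDist B x : ℝ) ≤ N := by exact_mod_cast columnDist_le B x
            gcongr
    refine ⟨fun x => min (f x) (g x), fun x => le_min (hf0 x) (hg0 x),
      fun x => (min_le_right _ _).trans ((hgH x).trans_eq (by rw [h2p])), fun t ht1 ht2 => ?_⟩
    have hclose := hT (t + 1) ht1 ht2
    set q := learningTPM K β₀ θ t with hq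
    have hq0 : ∀ x y, 0 ≤ q x y := learningTPM_nonneg β₀ θ t
    have hq1 : ∀ x, ∑ y, q x y = 1 := sum_learningTPM hN β₀ θ t
    have hqr : ∀ x y, q x y ≤ κ * r x y := fun x y => by
      simp only [hq, learningTPM, Matrix.of_apply, hr, Finset.mul_sum]
      refine Finset.sum_le_sum fun k _ => ?_
      rw [mul_left_comm]
      exact mul_le_mul_of_nonneg_left (gibbsCond_le_mul (hclose k) k x y) (by positivity)
    have hrq : ∀ x y, r x y ≤ κ * q x y := fun x y => by
      simp only [hq, learningTPM, Matrix.of_apply, hr, Finset.mul_sum]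
      refine Finset.sum_le_sum fun k _ => ?_
      rw [mul_left_comm]
      exact mul_le_mul_of_nonneg_left (gibbsCond_le_mul
        (fun A => by rw [abs_sub_comm]; exact hclose k A) k x y) (by positivity)
    have hminf : ∀ x, ∑ y, q x y * min (f y) (g y) ≤ ∑ y, q x y * f y := fun x =>
      Finset.sum_le_sum fun y _ => mul_le_mul_of_nonneg_left (min_le_left _ _) (hq0 x y)
    have hming : ∀ x, ∑ y, q x y * min (f y) (g y) ≤ ∑ y, q x y * g y := fun x =>
      Finset.sum_le_sum fun y _ => mul_le_mul_of_nonneg_left (min_le_right _ _) (hq0 x y)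
    refine ⟨fun x hx => ?_, ?_⟩
    · rw [← min_sub_sub_right]
      refine le_min ((hminf x).trans ?_) ((hming x).trans ?_)
      · have := hfd x (Finset.mem_erase.2 ⟨hx, Finset.mem_univ _⟩) (q x) fun y _ _ =>
          ⟨by rw [div_le_iff₀ hκ0, mul_comm]; exact hrq x y, hqr x y⟩
        simp_rw [mul_sub, Finset.sum_sub_distrib, ← Finset.sum_mul, hq1, one_mul] at this
        linarith
      · refine rank_lyapunov hq0 hq1 (columnDist B) N (columnDist_le B) (fun x y hxy => ?_)
          hp0 hp1 x ?_
        · by_contra hcon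
          apply hxy
          simp only [hq, learningTPM, Matrix.of_apply]
          refine Finset.sum_eq_zero fun k _ => ?_
          rw [gibbsCond, if_neg fun hk => hcon (columnDist_le_succ hk), mul_zero]
        · obtain ⟨k, y, hky, hdy⟩ := exists_columnDist_lt hx
          refine ⟨y, hdy, ?_⟩
          have h1 : p ≤ 1 / (N : ℝ) * gibbsCond (invTemp N β₀ (t + 1))
              (hitRate fun i s => θ k i s (t + 1)) k x y := by
            refine mul_le_mul_of_nonneg_left (le_gibbsCond hky fun C => ?_) (by positivity)
            have h1 := (abs_le.1 (hclose k C)).2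
            have h2 := (abs_le.1 (hclose k y)).1
            have h3 := mul_le_mul_of_nonneg_left (hΔ C y) (hb0 T)
            linarith
          refine h1.trans ?_
          simp only [hq, learningTPM, Matrix.of_apply]
          exact Finset.single_le_sum (f := fun k => 1 / (N : ℝ) * gibbsCond (invTemp N β₀ (t + 1))
            (hitRate fun i s => θ k i s (t + 1)) k x y)
            (fun k _ => mul_nonneg (by positivity) (gibbsCond_nonneg _ _ _ _ _))
            (Finset.mem_univ k)
    · have hπ : 0 < Real.exp (b T * h B) := Real.exp_pos _
      have h1 : ∑ y, q B y * f y ≤ κ * ∑ y, r B y * f y := by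
        rw [Finset.mul_sum]
        refine Finset.sum_le_sum fun y _ => ?_
        rw [← mul_assoc]
        exact mul_le_mul_of_nonneg_right (hqr B y) (hf0 y)
      have h2 : κ ^ (e + 1) * Real.exp (b T * (h B - γ))
          ≤ Real.exp (-(b T * (γ / 2))) * Real.exp (b T * h B) := by
        rw [hκdef, ← Real.exp_nat_mul, ← Real.exp_add, ← Real.exp_add]
        refine Real.exp_le_exp.2 ?_
        have := mul_le_mul_of_nonneg_left hε1 (hb0 T)
        push_cast
        linarith
      have h3 : ∑ x ∈ Finset.univ.erase B, Real.exp (b T * h x) * 1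
          ≤ c * Real.exp (b T * (h B - γ)) := by
        calc _ ≤ ∑ x ∈ Finset.univ.erase B, Real.exp (b T * (h B - γ)) := by
              refine Finset.sum_le_sum fun x hx => ?_
              rw [mul_one]
              have := hγ x (Finset.ne_of_mem_erase hx)
              exact Real.exp_le_exp.2 (mul_le_mul_of_nonneg_left (by linarith) (hb0 T))
          _ ≤ ∑ x : Config M N K, Real.exp (b T * (h B - γ)) :=
              Finset.sum_le_sum_of_subset_of_nonneg (Finset.erase_subset _ _)
                fun _ _ _ => (Real.exp_pos _).le
          _ = _ := by simp [hcdef]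
      refine (hminf B).trans (h1.trans ?_)
      refine le_of_mul_le_mul_left ?_ hπ
      calc Real.exp (b T * h B) * (κ * ∑ y, r B y * f y)
          = κ * (Real.exp (b T * h B) * ∑ y, r B y * f y) := by ring
        _ ≤ κ * (κ ^ e * (c * Real.exp (b T * (h B - γ)))) := by
            refine mul_le_mul_of_nonneg_left ?_ hκ0.le
            exact hfη.trans (mul_le_mul_of_nonneg_left h3 (by positivity))
        _ = c * (κ ^ (e + 1) * Real.exp (b T * (h B - γ))) := by ring
        _ ≤ c * (Real.exp (-(b T * (γ / 2))) * Real.exp (b T * h B)) := by gcongr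
        _ = _ := by ring

end Gibbs

/-! ### Averaging over the estimates -/

/-- The conditional law, given the initial information, of a chain whose transition matrices are
part of the initial information. -/
theorem condExp_law_eq {S : Type*} [Fintype S] [DecidableEq S] {Ω : Type*} {mΩ : MeasurableSpace Ω}
    (P : Measure Ω) [IsProbabilityMeasure P] (ℱ : Filtration ℕ mΩ) (Q : ℕ → Ω → Matrix S S ℝ)
    (hQm : ∀ t x y, Measurable[ℱ 0] fun ω => Q t ω x y)
    (hQ0 : ∀ t ω x y, 0 ≤ Q t ω x y) (hQ1 : ∀ t ω x, ∑ y, Q t ω x y = 1) (V : ℕ → Ω → S)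
    (hV : ∀ t A, MeasurableSet[ℱ t] {ω | V t ω = A})
    (hstep : ∀ t A, P[Set.indicator {ω | V (t + 1) ω = A} (fun _ => (1 : ℝ)) | ℱ t] =ᵐ[P]
      fun ω => Q t ω (V t ω) A) (t : ℕ) (A : S) :
    P[Set.indicator {ω | V t ω = A} (fun _ => (1 : ℝ)) | ℱ 0] =ᵐ[P]
      fun ω => Matrix.vecMul (Pi.single (V 0 ω) 1) (transition (fun t => Q t ω) 0 t) A := by
  have hint : ∀ t A, Integrable (Set.indicator {ω | V t ω = A} fun _ => (1 : ℝ)) P := fun t A =>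
    (integrable_const 1).indicator (ℱ.le t _ (hV t A))
  induction t generalizing A with
  | zero =>
    rw [condExp_of_stronglyMeasurable (ℱ.le 0) (stronglyMeasurable_const.indicator (hV 0 A))
      (hint 0 A)]
    refine Eventually.of_forall fun ω => ?_
    simp only [transition, Matrix.vecMul_one, Set.indicator, Set.mem_ofPred_eq, Pi.single_apply,
      eq_comm]
  | succ t ih =>
    have hQle : ∀ ω x y, Q t ω x y ≤ 1 := fun ω x y => by
      rw [← hQ1 t ω x]
      exact Finset.single_le_sum (fun y _ => hQ0 t ω x y) (Finset.mem_univ y)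
    have hbd : ∀ x, ∀ᵐ ω ∂P, ‖Q t ω x A‖ ≤ 1 := fun x => Eventually.of_forall fun ω => by
      rw [Real.norm_of_nonneg (hQ0 t ω x A)]; exact hQle ω x A
    have h1 := (condExp_condExp_of_le (f := Set.indicator {ω | V (t + 1) ω = A} fun _ => (1 : ℝ))
      (μ := P) (ℱ.mono (Nat.zero_le t)) (ℱ.le t)).symm
    -- Splitting by the value of `V t` leaves coefficients measurable at time 0, which can be pulled
    -- out of the conditional expectation.
    have h2 : (fun ω => Q t ω (V t ω) A) = ∑ x, (fun ω => Q t ω x A) *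
        Set.indicator {ω | V t ω = x} fun _ => (1 : ℝ) := by
      ext ω
      simp [Finset.sum_apply, Set.indicator]
    have h3 : ∀ x, Integrable ((fun ω => Q t ω x A) *
        Set.indicator {ω | V t ω = x} fun _ => (1 : ℝ)) P := fun x =>
      (hint t x).bdd_mul ((hQm t x A).mono (ℱ.le 0) le_rfl).aestronglyMeasurable (hbd x)
    have h4 : ∀ᵐ ω ∂P, ∀ x, (P[(fun ω => Q t ω x A) *
        Set.indicator {ω | V t ω = x} fun _ => (1 : ℝ) | ℱ 0]) ω
        = Q t ω x A * (P[Set.indicator {ω | V t ω = x} fun _ => (1 : ℝ) | ℱ 0]) ω := by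
      rw [ae_all_iff]
      intro x
      exact condExp_stronglyMeasurable_mul_of_bound (ℱ.le 0) (hQm t x A).stronglyMeasurable
        (hint t x) 1 (hbd x)
    have h5 : ∀ᵐ ω ∂P, ∀ x, (P[Set.indicator {ω | V t ω = x} fun _ => (1 : ℝ) | ℱ 0]) ω
        = Matrix.vecMul (Pi.single (V 0 ω) 1) (transition (fun t => Q t ω) 0 t) x := by
      rw [ae_all_iff]; exact ih
    have h6 := h1.trans (condExp_congr_ae (hstep t A))
    rw [h2] at h6
    filter_upwards [h6, condExp_finsetSum (s := Finset.univ) (fun x _ => h3 x) (ℱ 0), h4, h5]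
      with ω h6 h7 h4 h5
    rw [h6, h7, Finset.sum_apply]
    simp_rw [h4, h5]
    rw [transition, zero_add, ← Matrix.vecMul_vecMul]
    simp only [Matrix.vecMul, dotProduct]
    exact Finset.sum_congr rfl fun x _ => mul_comm _ _

theorem measurable_gibbsCond {M N K : ℕ} {Ω : Type*} [MeasurableSpace Ω] (β : ℝ)
    {H : Ω → Config M N K → ℝ} (hH : ∀ A, Measurable fun ω => H ω A) (j : Fin N)
    (B A : Config M N K) : Measurable fun ω => gibbsCond β (H ω) j B A := by
  classical
  unfold gibbsCond
  split_ifs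
  · refine ((hH A).const_mul β).exp.div (Finset.measurable_sum _ fun C _ => ?_)
    split_ifs
    · exact ((hH C).const_mul β).exp
    · exact measurable_const
  · exact measurable_const

theorem measurable_learningTPM {M N K : ℕ} {Ω : Type*} [MeasurableSpace Ω] (β₀ : ℝ)
    {θ : Fin N → Fin M → Finset (Fin N) → ℕ → Ω → ℝ} (hθ : ∀ k i s t, Measurable (θ k i s t))
    (t : ℕ) (x y : Config M N K) :
    Measurable fun ω => learningTPM K β₀ (fun k i s t => θ k i s t ω) t x y := by
  simp only [learningTPM, Matrix.of_apply]
  refine Finset.measurable_sum _ fun k _ => (measurable_gibbsCond _ (fun A => ?_) k x y).const_mul _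
  exact Finset.measurable_sum _ fun s _ => Finset.measurable_sum _ fun i _ =>
    (hθ k i s (t + 1)).mul_const _

/-- Strong ergodicity for almost every realization of the transition matrices implies convergence
of the marginal laws. -/
theorem tendsto_law_of_stronglyErgodicTo {S : Type*} [Fintype S] [DecidableEq S] {Ω : Type*}
    {mΩ : MeasurableSpace Ω}
    (P : Measure Ω) [IsProbabilityMeasure P] (ℱ : Filtration ℕ mΩ) (Q : ℕ → Ω → Matrix S S ℝ)
    (hQm : ∀ t x y, Measurable[ℱ 0] fun ω => Q t ω x y)
    (hQ0 : ∀ t ω x y, 0 ≤ Q t ω x y) (hQ1 : ∀ t ω x, ∑ y, Q t ω x y = 1) (V : ℕ → Ω → S)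
    (hV : ∀ t A, MeasurableSet[ℱ t] {ω | V t ω = A})
    (hstep : ∀ t A, P[Set.indicator {ω | V (t + 1) ω = A} (fun _ => (1 : ℝ)) | ℱ t] =ᵐ[P]
      fun ω => Q t ω (V t ω) A) (π : S → ℝ)
    (hπ : ∀ᵐ ω ∂P, StronglyErgodicTo (fun t => Q t ω) π) (A : S) :
    Tendsto (fun t : ℕ => P.real {ω | V t ω = A}) atTop (𝓝 (π A)) := by
  set ν : ℕ → Ω → S → ℝ := fun t ω =>
    Matrix.vecMul (Pi.single (V 0 ω) 1) (transition (fun t => Q t ω) 0 t) with hν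
  have hνs : ∀ t ω, ν t ω ∈ stdSimplex ℝ S := fun t ω =>
    vecMul_transition_mem_stdSimplex (fun t => hQ0 t ω) (fun t => hQ1 t ω) 0 t
      (single_mem_stdSimplex ℝ _)
  have hνae : ∀ t, P[Set.indicator {ω | V t ω = A} (fun _ => (1 : ℝ)) | ℱ 0] =ᵐ[P]
      fun ω => ν t ω A := fun t => condExp_law_eq P ℱ Q hQm hQ0 hQ1 V hV hstep t A
  have hlaw : ∀ t, P.real {ω | V t ω = A} = ∫ ω, ν t ω A ∂P := fun t => by
    rw [← integral_congr_ae (hνae t), integral_condExp (ℱ.le 0),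
      integral_indicator_const _ (ℱ.le t _ (hV t A))]
    simp
  have hle : ∀ t ω B, ν t ω B ≤ 1 := fun t ω B => by
    rw [← (hνs t ω).2]
    exact Finset.single_le_sum (fun y _ => (hνs t ω).1 y) (Finset.mem_univ B)
  simp_rw [hlaw]
  rw [show π A = ∫ _, π A ∂P by simp]
  refine tendsto_integral_of_dominated_convergence (fun _ => 1) (fun t => ?_)
    (integrable_const 1) (fun t => Eventually.of_forall fun ω => ?_) ?_
  · exact ((stronglyMeasurable_condExp.mono (ℱ.le 0)).aestronglyMeasurable).congr (hνae t)
  · rw [Real.norm_of_nonneg ((hνs t ω).1 A)]; exact hle t ω A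
  · filter_upwards [hπ] with ω hω
    rw [tendsto_iff_dist_tendsto_zero]
    have h2 := (hω.2 0).const_mul 2
    rw [mul_zero] at h2
    refine squeeze_zero (fun _ => dist_nonneg) (fun t => ?_) h2
    have hbdd : BddAbove (Set.range fun μ : stdSimplex ℝ S =>
        tvDist (Matrix.vecMul (μ : S → ℝ) (transition (fun t => Q t ω) 0 t)) π) := by
      refine ⟨1 / 2 * ∑ x, (1 + |π x|), ?_⟩
      rintro _ ⟨μ, rfl⟩
      have hμ : Matrix.vecMul (μ : S → ℝ) (transition (fun t => Q t ω) 0 t) ∈ stdSimplex ℝ S :=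
        vecMul_transition_mem_stdSimplex (fun t => hQ0 t ω) (fun t => hQ1 t ω) 0 t μ.2
      refine mul_le_mul_of_nonneg_left (Finset.sum_le_sum fun x _ => ?_) (by norm_num)
      refine (abs_sub _ _).trans (add_le_add_left ?_ _)
      rw [abs_of_nonneg (hμ.1 x), ← hμ.2]
      exact Finset.single_le_sum (fun y _ => hμ.1 y) (Finset.mem_univ x)
    -- The supremum over initial distributions covers the random starting point `V 0 ω`.
    have h3 := le_ciSup hbdd ⟨_, single_mem_stdSimplex ℝ (V 0 ω)⟩
    have h4 : |ν t ω A - π A| ≤ 2 * tvDist (ν t ω) π := by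
      rw [tvDist, ← mul_assoc]
      norm_num
      exact Finset.single_le_sum (f := fun x => |ν t ω x - π x|) (fun _ _ => abs_nonneg _)
        (Finset.mem_univ A)
    rw [Real.dist_eq]
    exact h4.trans (mul_le_mul_of_nonneg_left h3 (by norm_num))

end CacheGibbs

theorem theorem5 {M N K : ℕ} (hN : 0 < N) (hK : K < M)
    (lam : Fin M → ℝ) (hlam : ∀ i, 0 ≤ lam i)
    (cell : Fin N → Set CacheGibbs.Plane)
    (hcell : ∀ j, MeasurableSet (cell j)) (hfin : ∀ j, volume (cell j) ≠ ⊤)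
    (h : CacheGibbs.Config M N K → ℝ)
    (hh : h = CacheGibbs.hitRate (CacheGibbs.requestRate lam cell))
    (β₀ : ℝ) (hβ₀ : 0 < β₀)
    (hβΔ : β₀ * (N : ℝ) * ((⨆ B, h B) - ⨅ B, h B) < 1)
    (hβmax : β₀ * (⨆ B, h B) < 1)
    {Ω : Type*} [mΩ : MeasurableSpace Ω] (P : Measure Ω) [IsProbabilityMeasure P]
    (θ : Fin N → Fin M → Finset (Fin N) → ℕ → Ω → ℝ)
    (hθ : ∀ k i s, ∀ᵐ ω ∂P, Tendsto (fun t : ℕ => θ k i s t ω) atTop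
      (𝓝 (CacheGibbs.requestRate lam cell i s)))
    (huniq : ∃ Bopt, CacheGibbs.argmax h = {Bopt}) :
    ∃ π : CacheGibbs.Config M N K → ℝ,
      ∑ B, (CacheGibbs.argmax h).indicator π B = 1 ∧
      (∀ᵐ ω ∂P, CacheGibbs.StronglyErgodicTo
        (CacheGibbs.learningTPM K β₀ fun k i s t => θ k i s t ω) π) ∧
      ∀ (ℱ : Filtration ℕ mΩ) (V : ℕ → Ω → CacheGibbs.Config M N K),
        CacheGibbs.IsLearningChain P β₀ θ ℱ V →
        ∀ B, Tendsto (fun t : ℕ => P.real {ω | V t ω = B}) atTop (𝓝 (π B)) := by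
  obtain ⟨Bopt, hB⟩ := huniq
  have hmax : ∀ x, h x ≤ h Bopt := by
    have : Bopt ∈ CacheGibbs.argmax h := by rw [hB]; rfl
    exact this
  have hlt : ∀ x, x ≠ Bopt → h x < h Bopt := fun x hx => by
    refine lt_of_le_of_ne (hmax x) fun heq => hx ?_
    have : x ∈ CacheGibbs.argmax h := fun B' => heq ▸ hmax B'
    rwa [hB] at this
  obtain ⟨γ, hγ0, hγ⟩ : ∃ γ, 0 < γ ∧ ∀ x, x ≠ Bopt → h x + γ ≤ h Bopt := by
    rcases (Finset.univ.erase Bopt).eq_empty_or_nonempty with he | hne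
    -- With a single placement there is no competitor, and any positive gap will do.
    · refine ⟨1, one_pos, fun x hx => ?_⟩
      have : x ∈ Finset.univ.erase Bopt := Finset.mem_erase.2 ⟨hx, Finset.mem_univ _⟩
      rw [he] at this
      exact absurd this (Finset.notMem_empty _)
    · obtain ⟨z, hz, hzmax⟩ := Finset.exists_max_image _ h hne
      refine ⟨h Bopt - h z, sub_pos.2 (hlt z (Finset.ne_of_mem_erase hz)), fun x hx => ?_⟩
      linarith [hzmax x (Finset.mem_erase.2 ⟨hx, Finset.mem_univ _⟩)]
  have hΔ : ∀ x y, h x - h y ≤ (⨆ B, h B) - ⨅ B, h B := fun x y =>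
    sub_le_sub (le_ciSup (Set.finite_range h).bddAbove x)
      (ciInf_le (Set.finite_range h).bddBelow y)
  have herg : ∀ᵐ ω ∂P, CacheGibbs.StronglyErgodicTo
      (CacheGibbs.learningTPM K β₀ fun k i s t => θ k i s t ω) (Pi.single Bopt 1) := by
    have hθ' : ∀ᵐ ω ∂P, ∀ k i s, Tendsto (fun t : ℕ => θ k i s t ω) atTop
        (𝓝 (CacheGibbs.requestRate lam cell i s)) := by
      simp only [ae_all_iff]
      exact hθ
    filter_upwards [hθ'] with ω hω
    refine CacheGibbs.stronglyErgodicTo_learningTPM hN h Bopt hγ0 hγ hΔ hβ₀ hβΔ _ fun k A => ?_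
    rw [hh]
    exact tendsto_finsetSum _ fun s _ => tendsto_finsetSum _ fun i _ => (hω k i s).mul_const _
  refine ⟨Pi.single Bopt 1, ?_, herg, fun ℱ V hV B => ?_⟩
  · rw [hB, Finset.sum_eq_single Bopt]
    · simp
    · intro x _ hx
      simp [hx]
    · simp
  · exact CacheGibbs.tendsto_law_of_stronglyErgodicTo P ℱ
      (fun t ω => CacheGibbs.learningTPM K β₀ (fun k i s t => θ k i s t ω) t)
      (fun t x y => @CacheGibbs.measurable_learningTPM M N K Ω (ℱ 0) β₀ θ hV.estimates t x y)
      (fun t ω => CacheGibbs.learningTPM_nonneg β₀ _ t)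
      (fun t ω => CacheGibbs.sum_learningTPM hN β₀ _ t) V hV.adapted hV.step _ herg B
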